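/- Let $F$ be a field, and let $p(F)$ be the additive order of the identity of $F$ (so $p(F)$ is a prime or $+\infty$). Let $m,n,k$ be nonnegative integers, let $A_1,\ldots,A_n$ be finite nonempty subsets of $F$ with $|A_j|\in\{k,k+1\}$ for $1\le j\le n$, and let $S_{ij}$ $(1\le i\ne j\le n)$ be finite subsets of $F$ with $|S_{ij}|=m$. Put $$C=\{a_1+\cdots+a_n : a_1\in A_1,\ldots,a_n\in A_n,\ a_i-a_j\notin S_{ij}\text{ if } i\ne j\}.$$ If $p(F)>\max\bigl\{mn,\ \sum_{j=1}^n(|A_j|-1)-mn(n-1)\bigr\}$, then $$|C|\ \ge\ \sum_{j=1}^n(|A_j|-1)-mn(n-1)+1.$$ -/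

import Mathlib

open Finset

/-- The additive order of the identity of a field `F`, with value `⊤` (infinity) when the identity
has infinite additive order, which is the case in which `addOrderOf` returns `0`. -/
noncomputable def orderOfIdentity (F : Type*) [Field F] : WithTop ℤ :=
  if addOrderOf (1 : F) = 0 then ⊤ else ((addOrderOf (1 : F) : ℤ) : WithTop ℤ)

/-- The restricted sumset of all `a₁ + ⋯ + aₙ` with `aⱼ ∈ Aⱼ` for all `j`, and
`aᵢ - aⱼ ∉ Sᵢⱼ` whenever `i ≠ j`. -/
def restrictedSumset {F : Type*} [Field F] {n : ℕ} (A : Fin n → Finset F)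
    (S : Fin n → Fin n → Finset F) : Set F :=
  {c | ∃ a : Fin n → F, (∀ j, a j ∈ A j) ∧ (∀ i j, i ≠ j → a i - a j ∉ S i j) ∧
    c = ∑ j, a j}

/-!
The proof is the polynomial method. Write `eⱼ = |Aⱼ| - 1`, let `N = ∑ eⱼ - m n (n - 1)`, which may be
assumed nonnegative, and let `D = ∏_{i ≠ j} (xᵢ - xⱼ) ^ m`. If the restricted sumset had at most `N`
elements, then the product of `∏_c (∑ xᵢ - c)` over the sumset, a suitable power of `∑ xᵢ`, and all
`xᵢ - xⱼ - s` with `s ∈ Sᵢⱼ` would vanish on `∏ Aⱼ` while its leading form is `(∑ xᵢ) ^ N * D`. By the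
Combinatorial Nullstellensatz this is impossible as soon as the coefficient of `∏ xⱼ ^ eⱼ` in that
leading form is nonzero in `F` (`lt_ncard_restrictedSumset_of_coeff_ne_zero`).

The coefficient is computed over `ℤ`. By the multinomial theorem it is `N! / ∏ eⱼ!` times the value
at `D` of the functional that sends `∏ xⱼ ^ αⱼ` to `∏ eⱼ (eⱼ - 1) ⋯ (eⱼ - αⱼ + 1)`
(`coeff_sum_X_pow_mul`). Up to sign this is the functional `L_a` with
`L_a (∏ xⱼ ^ αⱼ) = ∏ aⱼ (aⱼ + 1) ⋯ (aⱼ + αⱼ - 1)` at `a = -e`. For positive `a` the functional `L_a` is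
integration against the Gamma densities `xⱼ ^ (aⱼ - 1) exp (-xⱼ) / Γ(aⱼ)`, so `L_a D` for constant
`a` is the Laguerre form of Selberg's integral. It is evaluated algebraically by Aomoto's method:
integration by parts together with the antisymmetry of `D / (xᵢ - xⱼ)` gives
`L_a (xᵢ x_T D) = (a + m (n - 1 - |T|)) L_a (x_T D)` for `i ∉ T`
(`risingMoment_X_mul_prod_X_mul_diffProd`), where `x_T = ∏_{t ∈ T} xₜ`. For `T` running up to the full
set this relates `L_{a+1} D` to `L_a D`, and integration by parts at the boundary reduces `L_1 D` in
`n + 1` variables to `L_{2m+1} D` in `n` variables. This evaluates `L_a D` at all positive integers,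
hence at all integers because `L_a D` is a polynomial in `a` (`risingMoment_diffProd`).

The exponents `eⱼ` take at most two consecutive values, and Aomoto's recursion for partial products
`x_T` is exactly what handles such a mixture. The outcome is that the coefficient divides
`N! ∏_{j ≤ n} (j m)!` (`exists_coeff_mul_eq`), which is nonzero in `F` because
`p(F) > max (m n, N)`.
-/

/-! ### The rising factorial functional -/

open MvPolynomial

/-- The linear functional on integer polynomials that sends `∏ xⱼ ^ αⱼ` to the product of the rising
factorials `aⱼ (aⱼ + 1) ⋯ (aⱼ + αⱼ - 1)`. For positive `aⱼ` it is the expectation with respect to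
independent Gamma variables of shape `aⱼ`; here `a` may be any integer vector. -/
noncomputable def risingMoment {σ : Type*} [Fintype σ] (a : σ → ℤ) : MvPolynomial σ ℤ →ₗ[ℤ] ℤ :=
  (basisMonomials σ ℤ).constr ℤ fun α => ∏ j, (ascPochhammer ℤ (α j)).eval (a j)

section RisingMoment

variable {σ : Type*} [Fintype σ]

theorem risingMoment_monomial (a : σ → ℤ) (α : σ →₀ ℕ) (c : ℤ) :
    risingMoment a (monomial α c) = c * ∏ j, (ascPochhammer ℤ (α j)).eval (a j) := by
  have h : (monomial α c : MvPolynomial σ ℤ) = c • basisMonomials σ ℤ α := by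
    simp [smul_monomial]
  rw [h, map_smul, risingMoment, Module.Basis.constr_basis, smul_eq_mul]

theorem ascPochhammer_eval_add (x : ℤ) (k l : ℕ) :
    (ascPochhammer ℤ (k + l)).eval x =
      (ascPochhammer ℤ k).eval x * (ascPochhammer ℤ l).eval (x + k) := by
  rw [← ascPochhammer_mul]; simp

theorem risingMoment_monomial_mul (a : σ → ℤ) (β : σ →₀ ℕ) (f : MvPolynomial σ ℤ) :
    risingMoment a (monomial β 1 * f) =
      (∏ j, (ascPochhammer ℤ (β j)).eval (a j)) * risingMoment (fun j => a j + β j) f := by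
  induction f using MvPolynomial.induction_on' with
  | monomial α c =>
    rw [monomial_mul, risingMoment_monomial, risingMoment_monomial, one_mul, mul_left_comm,
      ← prod_mul_distrib]
    simp only [Finsupp.add_apply, ascPochhammer_eval_add]
  | add p q hp hq => rw [mul_add, map_add, map_add, hp, hq, mul_add]

theorem risingMoment_prod_X_mul [DecidableEq σ] (a : σ → ℤ) (T : Finset σ) (f : MvPolynomial σ ℤ) :
    risingMoment a ((∏ t ∈ T, X t) * f) =
      (∏ t ∈ T, a t) * risingMoment (fun j => a j + if j ∈ T then 1 else 0) f := by
  have h : (∏ t ∈ T, X t : MvPolynomial σ ℤ) =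
      monomial (Finsupp.equivFunOnFinite.symm fun j => if j ∈ T then 1 else 0) 1 := by
    rw [monomial_eq, Finsupp.prod_fintype _ _ (by simp)]
    simp [prod_ite_mem, pow_ite]
  rw [h, risingMoment_monomial_mul]
  congr 1
  · rw [← Finset.prod_subset (Finset.subset_univ T)]
    · exact prod_congr rfl fun t ht => by simp [ht]
    · intro t _ ht; simp [ht]
  · congr 2; ext j; simp

theorem ascPochhammer_eval_add_one_sub (x : ℤ) (k : ℕ) :
    (ascPochhammer ℤ (k + 1)).eval (x + 1) - (ascPochhammer ℤ (k + 1)).eval x =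
      (k + 1) * (ascPochhammer ℤ k).eval (x + 1) := by
  rw [ascPochhammer_succ_eval, add_comm k 1, ascPochhammer_eval_add, ascPochhammer_one]
  simp; ring

/-- Integration by parts for the weights `xⱼ ^ (aⱼ - 1) exp (-xⱼ)`, in a normalization that keeps its
meaning at `aᵢ = 0`, where `risingMoment a f` becomes the boundary term. -/
theorem risingMoment_pderiv [DecidableEq σ] (a : σ → ℤ) (i : σ) (f : MvPolynomial σ ℤ) :
    risingMoment (a + Pi.single i 1) (pderiv i f) =
      risingMoment (a + Pi.single i 1) f - risingMoment a f := by
  induction f using MvPolynomial.induction_on' with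
  | monomial α c =>
    simp only [pderiv_monomial, risingMoment_monomial]
    rw [← mul_prod_erase univ _ (mem_univ i), ← mul_prod_erase univ _ (mem_univ i),
      ← mul_prod_erase univ _ (mem_univ i)]
    have h1 : ∀ j ∈ univ.erase i, (ascPochhammer ℤ (α j)).eval ((a + Pi.single i 1 : σ → ℤ) j) =
        (ascPochhammer ℤ (α j)).eval (a j) := by
      intro j hj
      simp [ne_of_mem_erase hj]
    have h2 : ∀ j ∈ univ.erase i, (ascPochhammer ℤ ((α - Finsupp.single i 1 : σ →₀ ℕ) j)).eval
        ((a + Pi.single i 1 : σ → ℤ) j) = (ascPochhammer ℤ (α j)).eval (a j) := by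
      intro j hj
      simp [ne_of_mem_erase hj]
    rw [prod_congr rfl h1, prod_congr rfl h2]
    simp only [Pi.add_apply, Pi.single_eq_same, Finsupp.coe_tsub, Pi.sub_apply,
      Finsupp.single_eq_same]
    rcases h : α i with _ | k
    · simp
    · have := ascPochhammer_eval_add_one_sub (a i) k
      push_cast
      linear_combination (-c * ∏ j ∈ univ.erase i, (ascPochhammer ℤ (α j)).eval (a j)) * this
  | add p q hp hq => simp only [map_add, hp, hq]; ring

theorem risingMoment_X_mul_pderiv (a : σ → ℤ) (i : σ) (f : MvPolynomial σ ℤ) :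
    risingMoment a (X i * pderiv i f) = risingMoment a (X i * f) - a i * risingMoment a f := by
  classical
  have key : ∀ g, risingMoment a (X i * g) = a i * risingMoment (a + Pi.single i 1) g := by
    intro g
    have := risingMoment_prod_X_mul a {i} g
    simp only [prod_singleton] at this
    rw [this]
    congr 3
    ext j; simp [Pi.single_apply]
  rw [key, key, risingMoment_pderiv]; ring

theorem risingMoment_rename (a : σ → ℤ) (e : Equiv.Perm σ) (ha : ∀ j, a (e j) = a j)
    (f : MvPolynomial σ ℤ) : risingMoment a (rename e f) = risingMoment a f := by
  induction f using MvPolynomial.induction_on' with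
  | monomial α c =>
    rw [rename_monomial, risingMoment_monomial, risingMoment_monomial]
    congr 1
    rw [← Equiv.prod_comp e]
    refine prod_congr rfl fun j _ => ?_
    rw [ha, Finsupp.mapDomain_apply e.injective]
  | add p q hp hq => simp only [map_add, hp, hq]

theorem risingMoment_eq_zero_of_rename_eq_neg (a : σ → ℤ) (e : Equiv.Perm σ)
    (ha : ∀ j, a (e j) = a j) {f : MvPolynomial σ ℤ} (hf : rename e f = -f) :
    risingMoment a f = 0 := by
  have h := risingMoment_rename a e ha f
  rw [hf, map_neg] at h
  linarith

/-- A variable with parameter `0` is evaluated at `0`. -/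
theorem risingMoment_cons_zero {n : ℕ} (a : Fin n → ℤ) (f : MvPolynomial (Fin (n + 1)) ℤ) :
    risingMoment (Fin.cons 0 a : Fin (n + 1) → ℤ) f =
      risingMoment a (aeval (Fin.cons 0 X : Fin (n + 1) → MvPolynomial (Fin n) ℤ) f) := by
  induction f using MvPolynomial.induction_on' with
  | monomial α c =>
    have h : aeval (Fin.cons 0 X : Fin (n + 1) → MvPolynomial (Fin n) ℤ) (monomial α c) =
        monomial α.tail (c * 0 ^ α 0) := by
      rw [aeval_monomial, Finsupp.prod_fintype _ _ (by simp), Fin.prod_univ_succ, monomial_eq,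
        Finsupp.prod_fintype _ _ (by simp)]
      simp only [Fin.cons_zero, Fin.cons_succ, Finsupp.tail_apply]
      simp [mul_assoc]
    rw [h, risingMoment_monomial, risingMoment_monomial, Fin.prod_univ_succ]
    simp only [Fin.cons_zero, Fin.cons_succ, Finsupp.tail_apply]
    rcases h : α 0 with _ | k
    · simp
    · simp [ascPochhammer_ne_zero_eval_zero]
  | add p q hp hq => simp only [map_add, hp, hq]

theorem exists_polynomial_eval_eq_risingMoment (f : MvPolynomial σ ℤ) :
    ∃ P : Polynomial ℤ, ∀ a : ℤ, P.eval a = risingMoment (fun _ => a) f := by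
  induction f using MvPolynomial.induction_on' with
  | monomial α c =>
    refine ⟨Polynomial.C c * ∏ j, ascPochhammer ℤ (α j), fun a => ?_⟩
    rw [risingMoment_monomial]
    simp [Polynomial.eval_prod]
  | add p q hp hq =>
    obtain ⟨P, hP⟩ := hp
    obtain ⟨Q, hQ⟩ := hq
    exact ⟨P + Q, fun a => by simp [hP, hQ]⟩

end RisingMoment

/-! ### The product of powers of differences -/

section DiffProd

theorem prod_offDiag_univ {σ M : Type*} [Fintype σ] [DecidableEq σ] [CommMonoid M]
    (f : σ × σ → M) :
    ∏ p ∈ (univ : Finset σ).offDiag, f p = ∏ i, ∏ j, if i = j then 1 else f (i, j) := by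
  have h : (univ : Finset σ).offDiag = univ.filter fun p : σ × σ => p.1 ≠ p.2 := by ext; simp
  rw [h, prod_filter, ← univ_product_univ, prod_product]
  simp only [ne_eq, ite_not]

theorem pderiv_prod {σ R ι : Type*} [CommRing R] [DecidableEq ι] (s : Finset ι)
    (f : ι → MvPolynomial σ R) (i : σ) :
    pderiv i (∏ p ∈ s, f p) = ∑ p ∈ s, (∏ q ∈ s.erase p, f q) * pderiv i (f p) := by
  induction s using Finset.induction_on with
  | empty => simp
  | insert a s ha ih =>
    rw [prod_insert ha, pderiv_mul, ih, sum_insert ha, erase_insert ha, mul_sum]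
    congr 1
    · ring
    · refine sum_congr rfl fun p hp => ?_
      have hpa : a ≠ p := fun h => ha (h ▸ hp)
      rw [erase_insert_of_ne hpa, prod_insert (by simp [ha])]
      ring

theorem X_sub_X_ne_zero {σ : Type*} {i j : σ} (hij : i ≠ j) :
    (X i - X j : MvPolynomial σ ℤ) ≠ 0 :=
  sub_ne_zero.mpr fun h => hij (X_injective h)

variable (σ : Type*) [Fintype σ] (R : Type*) [CommRing R] (m : ℕ)

/-- The product of `(xᵢ - xⱼ) ^ m` over all ordered pairs with `i ≠ j`. Taking ordered pairs makes it
invariant under all permutations of the variables, without sign. -/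
noncomputable def diffProd : MvPolynomial σ R :=
  ∏ p ∈ (univ : Finset σ).offDiag, (X p.1 - X p.2) ^ m

theorem diffProd_eq_prod_prod [DecidableEq σ] :
    diffProd σ R m = ∏ i, ∏ j, if i = j then 1 else (X i - X j) ^ m :=
  prod_offDiag_univ _

theorem isHomogeneous_diffProd :
    (diffProd σ R m).IsHomogeneous (m * (Fintype.card σ * (Fintype.card σ - 1))) := by
  have h := IsHomogeneous.prod (univ : Finset σ).offDiag
    (fun p => (X p.1 - X p.2 : MvPolynomial σ R) ^ m) (fun _ => m) fun p _ => by
      simpa using ((isHomogeneous_X R p.1).sub (isHomogeneous_X R p.2)).pow m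
  rw [sum_const, offDiag_card, smul_eq_mul, card_univ, mul_comm] at h
  rw [Nat.mul_sub_one]
  exact h

theorem map_diffProd {S : Type*} [CommRing S] (g : R →+* S) :
    map g (diffProd σ R m) = diffProd σ S m := by
  simp [diffProd, map_prod]

variable {σ} [DecidableEq σ]

theorem rename_diffProd (e : Equiv.Perm σ) : rename e (diffProd σ R m) = diffProd σ R m := by
  rw [diffProd_eq_prod_prod]
  simp only [map_prod, apply_ite (rename e), map_one, map_pow, map_sub, rename_X]
  rw [← Equiv.prod_comp e.symm]
  refine prod_congr rfl fun i _ => ?_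
  rw [← Equiv.prod_comp e.symm]
  refine prod_congr rfl fun j _ => ?_
  simp

/-- The polynomial `m * diffProd / (xᵢ - xⱼ)`, for `i ≠ j`; the factor `m` makes the exponent `m - 1`
harmless when `m = 0`. -/
noncomputable def diffProdQuot (i j : σ) : MvPolynomial σ ℤ :=
  (m : MvPolynomial σ ℤ) * (X i - X j) ^ (m - 1) *
    ∏ q ∈ (univ : Finset σ).offDiag.erase (i, j), (X q.1 - X q.2) ^ m

variable {i j : σ}

theorem sub_mul_diffProdQuot (hij : i ≠ j) :
    (X i - X j) * diffProdQuot m i j = (m : MvPolynomial σ ℤ) * diffProd σ ℤ m := by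
  rw [diffProd, ← mul_prod_erase _ _ (show (i, j) ∈ (univ : Finset σ).offDiag by simp [hij]),
    diffProdQuot]
  rcases m with _ | m
  · simp
  · rw [Nat.add_sub_cancel, pow_succ]; ring

theorem diffProdQuot_swap (hij : i ≠ j) : diffProdQuot m j i = -diffProdQuot m i j := by
  apply mul_left_cancel₀ (X_sub_X_ne_zero hij)
  have h1 := sub_mul_diffProdQuot m hij
  have h2 := sub_mul_diffProdQuot m hij.symm
  linear_combination h1 - h2

theorem rename_swap_diffProdQuot (hij : i ≠ j) :
    rename (Equiv.swap i j) (diffProdQuot m i j) = -diffProdQuot m i j := by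
  rw [← diffProdQuot_swap m hij]
  apply mul_left_cancel₀ (X_sub_X_ne_zero hij.symm)
  rw [sub_mul_diffProdQuot m hij.symm]
  have h := congrArg (rename (Equiv.swap i j)) (sub_mul_diffProdQuot m hij)
  simpa [rename_diffProd] using h

theorem pderiv_diffProd (i : σ) :
    pderiv i (diffProd σ ℤ m) = 2 * ∑ j ∈ univ.erase i, diffProdQuot m i j := by
  have h1 : pderiv i (diffProd σ ℤ m) = ∑ p ∈ (univ : Finset σ).offDiag,
      diffProdQuot m p.1 p.2 * ((if p.1 = i then 1 else 0) - (if p.2 = i then 1 else 0)) := by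
    rw [diffProd, pderiv_prod]
    refine sum_congr rfl fun p _ => ?_
    rw [pderiv_pow, diffProdQuot, map_sub, pderiv_X, pderiv_X, Pi.single_apply, Pi.single_apply]
    ring
  have h2 : ∀ k l : σ, (if k = l then (0 : MvPolynomial σ ℤ) else
      diffProdQuot m k l * ((if k = i then 1 else 0) - (if l = i then 1 else 0))) =
      (if k = i then (if k = l then 0 else diffProdQuot m k l) else 0) -
      (if l = i then (if k = l then 0 else diffProdQuot m k l) else 0) := by
    intro k l; split_ifs <;> simp
  have h3 : (univ : Finset σ).offDiag = univ.filter fun p : σ × σ => p.1 ≠ p.2 := by ext; simp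
  rw [h1, h3, sum_filter, ← univ_product_univ, sum_product]
  simp only [ne_eq, ite_not, h2, sum_sub_distrib]
  rw [sum_comm]
  simp only [sum_ite_eq', mem_univ, if_true]
  rw [← sum_sub_distrib, mul_sum, ← sum_erase (a := i) univ (by simp)]
  refine sum_congr rfl fun j hj => ?_
  have hji := ne_of_mem_erase hj
  rw [if_neg hji.symm, if_neg hji, diffProdQuot_swap m hji.symm]
  ring

/-- Setting the first of `n + 1` variables to zero. -/
theorem aeval_cons_zero_diffProd (n : ℕ) :
    aeval (Fin.cons 0 X : Fin (n + 1) → MvPolynomial (Fin n) ℤ) (diffProd (Fin (n + 1)) ℤ m) =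
      (-1) ^ (m * n) * ((∏ j, X j ^ (2 * m)) * diffProd (Fin n) ℤ m) := by
  rw [diffProd_eq_prod_prod, diffProd_eq_prod_prod]
  simp only [Fin.prod_univ_succ, map_mul, map_prod, apply_ite (aeval _), map_one, map_pow, map_sub,
    aeval_X, Fin.cons_zero, Fin.cons_succ]
  simp only [if_true, one_mul, (Fin.succ_ne_zero _).symm, Fin.succ_ne_zero, if_false, Fin.succ_inj,
    zero_sub, sub_zero, prod_mul_distrib]
  rw [← mul_assoc, ← mul_assoc]
  congr 1
  rw [show ∀ f : Fin n → MvPolynomial (Fin n) ℤ, (∏ i, (-f i) ^ m) =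
    (-1) ^ (m * n) * ∏ i, f i ^ m from fun f => ?_]
  · rw [mul_assoc, ← prod_mul_distrib]
    congr 1
    exact prod_congr rfl fun j _ => by ring
  · have : ∀ i, (-f i) ^ m = (-1) ^ m * f i ^ m := fun i => by rw [neg_pow]
    simp only [this, prod_mul_distrib, prod_const, card_univ, Fintype.card_fin, pow_mul]

end DiffProd

/-! ### Aomoto's recursion and the Selberg-type evaluation -/

section Selberg

theorem pderiv_prod_X_of_notMem {σ : Type*} [DecidableEq σ] {T : Finset σ} {i : σ} (hi : i ∉ T) :
    pderiv i (∏ t ∈ T, X t : MvPolynomial σ ℤ) = 0 := by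
  rw [pderiv_prod]
  refine sum_eq_zero fun t ht => ?_
  rw [pderiv_X_of_ne (ne_of_mem_of_not_mem ht hi), mul_zero]

theorem rename_swap_prod_X {σ : Type*} [DecidableEq σ] {T : Finset σ} {i j : σ} (hi : i ∉ T) (hj : j ∉ T) :
    rename (Equiv.swap i j) (∏ t ∈ T, X t : MvPolynomial σ ℤ) = ∏ t ∈ T, X t := by
  rw [map_prod]
  refine prod_congr rfl fun t ht => ?_
  rw [rename_X, Equiv.swap_apply_of_ne_of_ne (ne_of_mem_of_not_mem ht hi)
    (ne_of_mem_of_not_mem ht hj)]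

section Aomoto

variable {σ : Type*} [Fintype σ] [DecidableEq σ] (m : ℕ)

/-- Exchanging `xᵢ` and `xⱼ` negates `diffProdQuot m i j`. If `j ∈ T`, the whole argument is
antisymmetric, so its value is `0`; otherwise `2 xᵢ = (xᵢ + xⱼ) + (xᵢ - xⱼ)`, where the first summand
contributes `0` by antisymmetry and the second restores `diffProd`. -/
theorem risingMoment_X_mul_diffProdQuot (a : ℤ) {T : Finset σ} {i j : σ} (hi : i ∉ T)
    (hij : i ≠ j) :
    2 * risingMoment (fun _ => a) (X i * ((∏ t ∈ T, X t) * diffProdQuot m i j)) =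
      m * risingMoment (fun _ => a) ((∏ t ∈ T, X t) * diffProd σ ℤ m) -
        if j ∈ T then m * risingMoment (fun _ => a) ((∏ t ∈ T, X t) * diffProd σ ℤ m) else 0 := by
  split_ifs with hj
  · rw [sub_self, risingMoment_eq_zero_of_rename_eq_neg _ (Equiv.swap i j) (fun _ => rfl), mul_zero]
    rw [← mul_prod_erase T _ hj]
    simp only [map_mul, rename_X, Equiv.swap_apply_left, Equiv.swap_apply_right,
      rename_swap_diffProdQuot m hij]
    rw [rename_swap_prod_X (fun h => hi (mem_of_mem_erase h)) (by simp)]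
    ring
  · have h0 : risingMoment (fun _ => a)
        ((X i + X j) * ((∏ t ∈ T, X t) * diffProdQuot m i j)) = 0 := by
      refine risingMoment_eq_zero_of_rename_eq_neg _ (Equiv.swap i j) (fun _ => rfl) ?_
      simp only [map_mul, map_add, rename_X, Equiv.swap_apply_left, Equiv.swap_apply_right,
        rename_swap_diffProdQuot m hij, rename_swap_prod_X hi hj]
      ring
    have h1 : (2 : ℤ) • (X i * ((∏ t ∈ T, X t) * diffProdQuot m i j)) =
        (X i + X j) * ((∏ t ∈ T, X t) * diffProdQuot m i j) +
        (m : ℤ) • ((∏ t ∈ T, X t) * diffProd σ ℤ m) := by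
      have := sub_mul_diffProdQuot m hij
      simp only [zsmul_eq_mul, Int.cast_natCast, Int.cast_ofNat]
      linear_combination (∏ t ∈ T, X t) * this
    have h2 := congrArg (risingMoment fun _ : σ => a) h1
    rw [map_add, map_smul, map_smul, h0, zero_add] at h2
    simpa using h2

/-- Aomoto's recursion. -/
theorem risingMoment_X_mul_prod_X_mul_diffProd (a : ℤ) {T : Finset σ} {i : σ} (hi : i ∉ T) :
    risingMoment (fun _ => a) (X i * ((∏ t ∈ T, X t) * diffProd σ ℤ m)) =
      (a + m * (Fintype.card σ - 1 - #T)) *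
        risingMoment (fun _ => a) ((∏ t ∈ T, X t) * diffProd σ ℤ m) := by
  have h := risingMoment_X_mul_pderiv (fun _ : σ => a) i ((∏ t ∈ T, X t) * diffProd σ ℤ m)
  have h1 : X i * pderiv i ((∏ t ∈ T, X t) * diffProd σ ℤ m) = (2 : ℤ) •
      ∑ j ∈ univ.erase i, X i * ((∏ t ∈ T, X t) * diffProdQuot m i j) := by
    rw [pderiv_mul, pderiv_prod_X_of_notMem hi, pderiv_diffProd, ← mul_sum, ← mul_sum,
      zsmul_eq_mul]
    push_cast; ring
  rw [h1, map_smul, map_sum, smul_eq_mul, mul_sum,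
    sum_congr rfl fun j hj => risingMoment_X_mul_diffProdQuot m a hi (ne_of_mem_erase hj).symm,
    sum_sub_distrib, sum_const, sum_ite_mem, inter_eq_right.mpr (fun t ht => mem_erase.mpr
      ⟨ne_of_mem_of_not_mem ht hi, mem_univ t⟩), sum_const, card_erase_of_mem (mem_univ i), card_univ,
    nsmul_eq_mul, nsmul_eq_mul, Nat.cast_sub (Fintype.card_pos_iff.mpr ⟨i⟩)] at h
  push_cast at h
  linear_combination -h

theorem risingMoment_prod_X_mul_diffProd (a : ℤ) (T : Finset σ) :
    risingMoment (fun _ => a) ((∏ t ∈ T, X t) * diffProd σ ℤ m) =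
      (∏ t ∈ range #T, (a + m * (Fintype.card σ - 1 - t))) *
        risingMoment (fun _ => a) (diffProd σ ℤ m) := by
  induction T using Finset.induction_on with
  | empty => simp
  | insert i T hi ih =>
    rw [prod_insert hi, mul_assoc, risingMoment_X_mul_prod_X_mul_diffProd m a hi, ih,
      card_insert_of_notMem hi, prod_range_succ]
    ring

theorem risingMoment_pderiv_diffProd (a : ℤ) (i : σ) :
    risingMoment (fun _ => a) (pderiv i (diffProd σ ℤ m)) = 0 := by
  rw [pderiv_diffProd, ← Int.cast_ofNat, ← zsmul_eq_mul, map_smul, map_sum, sum_eq_zero, smul_zero]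
  intro j hj
  exact risingMoment_eq_zero_of_rename_eq_neg _ (Equiv.swap i j) (fun _ => rfl)
    (rename_swap_diffProdQuot m (ne_of_mem_erase hj).symm)

end Aomoto

/-- Aomoto's recursion for the product of all variables, which shifts the parameter by one. -/
theorem risingMoment_add_one_diffProd (n m : ℕ) (a : ℤ) :
    a ^ n * risingMoment (fun _ => a + 1) (diffProd (Fin n) ℤ m) =
      (∏ j ∈ range n, (a + m * j)) * risingMoment (fun _ => a) (diffProd (Fin n) ℤ m) := by
  have h := risingMoment_prod_X_mul_diffProd m a (univ : Finset (Fin n))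
  rw [risingMoment_prod_X_mul] at h
  simp only [prod_const, card_univ, Fintype.card_fin, mem_univ, if_true] at h
  rw [h, ← prod_range_reflect]
  congr 1
  refine prod_congr rfl fun j hj => ?_
  have := mem_range.mp hj
  rw [Nat.sub_sub, Nat.cast_sub (by omega)]
  push_cast; ring

/-- At parameter `1` the integral of a derivative of `diffProd` vanishes by antisymmetry, so integration
by parts leaves the boundary term, in which one variable is set to zero. -/
theorem risingMoment_one_diffProd_succ (n m : ℕ) :
    risingMoment (fun _ => 1) (diffProd (Fin (n + 1)) ℤ m) =
      (-1) ^ (m * n) * ((2 * m).factorial : ℤ) ^ n *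
        risingMoment (fun _ => 2 * m + 1) (diffProd (Fin n) ℤ m) := by
  have h := risingMoment_pderiv (Fin.cons 0 fun _ => 1 : Fin (n + 1) → ℤ) 0
    (diffProd (Fin (n + 1)) ℤ m)
  have h1 : (Fin.cons 0 fun _ => 1 : Fin (n + 1) → ℤ) + Pi.single 0 1 = fun _ => 1 := by
    ext j; refine Fin.cases ?_ (fun i => ?_) j <;> simp
  rw [h1, risingMoment_pderiv_diffProd, risingMoment_cons_zero, aeval_cons_zero_diffProd] at h
  have h2 : (∏ j, X j ^ (2 * m) : MvPolynomial (Fin n) ℤ) =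
      monomial (Finsupp.equivFunOnFinite.symm fun _ => 2 * m) 1 := by
    rw [monomial_eq, Finsupp.prod_fintype _ _ (by simp)]; simp
  have h3 : ((-1) ^ (m * n) * ((∏ j, X j ^ (2 * m)) * diffProd (Fin n) ℤ m)) =
      ((-1) ^ (m * n) : ℤ) • ((∏ j, X j ^ (2 * m)) * diffProd (Fin n) ℤ m) := by
    rw [zsmul_eq_mul]; push_cast; rfl
  rw [h3, map_smul, h2, risingMoment_monomial_mul] at h
  simp only [Finsupp.equivFunOnFinite_symm_apply_apply, ascPochhammer_eval_one, prod_const,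
    card_univ, Fintype.card_fin, smul_eq_mul] at h
  rw [show (fun _ : Fin n => (2 * m + 1 : ℤ)) = fun _ => 1 + ((2 * m : ℕ) : ℤ) by
    ext; push_cast; ring]
  linear_combination -h

/-- The evaluation at positive integers, by induction on the number of variables and, within it, on
the parameter. -/
theorem risingMoment_diffProd_of_nat (n m b : ℕ) :
    (m.factorial : ℤ) ^ n * risingMoment (fun _ => b + 1) (diffProd (Fin n) ℤ m) =
      ∏ j ∈ range n, (-1) ^ (m * j) * ((m * (j + 1)).factorial : ℤ) *
        (ascPochhammer ℤ (m * j)).eval (b + 1 : ℤ) := by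
  induction n generalizing b with
  | zero =>
    have : diffProd (Fin 0) ℤ m = monomial 0 1 := by simp [diffProd]
    rw [this, risingMoment_monomial]; simp
  | succ n ihn =>
    induction b with
    | zero =>
      have h := ihn (2 * m)
      have h1 : ((2 * m).factorial : ℤ) ^ n * ∏ j ∈ range n, (-1) ^ (m * j) *
          ((m * (j + 1)).factorial : ℤ) * (ascPochhammer ℤ (m * j)).eval ((2 * m : ℕ) + 1 : ℤ) =
          ∏ j ∈ range n, (-1) ^ (m * j) * ((m * (j + 1)).factorial : ℤ) *
            ((m * (j + 1 + 1)).factorial : ℤ) := by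
        rw [← card_range n, ← prod_const, card_range, ← prod_mul_distrib]
        refine prod_congr rfl fun j _ => ?_
        have h2 := factorial_mul_ascPochhammer ℤ (2 * m) (m * j)
        rw [show m * (j + 1 + 1) = 2 * m + m * j by ring]
        linear_combination ((-1) ^ (m * j) * ((m * (j + 1)).factorial : ℤ)) * h2
      rw [← h] at h1
      push_cast at h1
      simp only [Nat.cast_zero, zero_add, ascPochhammer_eval_one, risingMoment_one_diffProd_succ]
      simp only [prod_mul_distrib] at h1 ⊢
      rw [prod_range_succ (fun j => (-1 : ℤ) ^ (m * j)),
        prod_range_succ' (fun j => ((m * (j + 1)).factorial : ℤ)),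
        prod_range_succ' (fun j => ((m * j).factorial : ℤ))]
      simp only [mul_zero, zero_add, mul_one, Nat.factorial_zero, Nat.cast_one]
      linear_combination ((m.factorial : ℤ) * (-1) ^ (m * n)) * h1
    | succ b ihb =>
      have h := risingMoment_add_one_diffProd (n + 1) m (b + 1)
      have hb : ((b + 1 : ℤ)) ^ (n + 1) ≠ 0 := by positivity
      apply mul_left_cancel₀ hb
      push_cast at h ⊢
      rw [mul_left_comm, h, mul_left_comm, ihb, ← prod_mul_distrib,
        ← card_range (n + 1), ← prod_const, card_range, ← prod_mul_distrib]
      refine prod_congr rfl fun j _ => ?_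
      have h1 := ascPochhammer_eval_add (b + 1) 1 (m * j)
      rw [add_comm 1, ascPochhammer_succ_eval] at h1
      simp at h1
      linear_combination ((-1) ^ (m * j) * ((m * (j + 1)).factorial : ℤ)) * h1

/-- The Laguerre form of Selberg's integral at an arbitrary integer parameter. The recursion in the
parameter breaks down at `0`, so the negative parameters are reached by polynomial continuation. -/
theorem risingMoment_diffProd (n m : ℕ) (a : ℤ) :
    (m.factorial : ℤ) ^ n * risingMoment (fun _ => a) (diffProd (Fin n) ℤ m) =
      ∏ j ∈ range n, (-1) ^ (m * j) * ((m * (j + 1)).factorial : ℤ) *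
        (ascPochhammer ℤ (m * j)).eval a := by
  obtain ⟨P, hP⟩ := exists_polynomial_eval_eq_risingMoment (diffProd (Fin n) ℤ m)
  set Q : Polynomial ℤ := ∏ j ∈ range n,
    Polynomial.C ((-1) ^ (m * j) * ((m * (j + 1)).factorial : ℤ)) * ascPochhammer ℤ (m * j) with hQ
  have hPQ : Polynomial.C ((m.factorial : ℤ) ^ n) * P = Q := by
    refine Polynomial.eq_of_infinite_eval_eq _ _ (Set.Infinite.mono (s := Set.range fun b : ℕ =>
      (b + 1 : ℤ)) ?_ (Set.infinite_range_of_injective fun b c h => by simpa using h))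
    rintro _ ⟨b, rfl⟩
    simp only [Set.mem_ofPred_eq, hQ, Polynomial.eval_mul, Polynomial.eval_C, hP,
      Polynomial.eval_prod]
    exact risingMoment_diffProd_of_nat n m b
  have h := congrArg (Polynomial.eval a) hPQ
  simpa only [hQ, Polynomial.eval_mul, Polynomial.eval_C, hP, Polynomial.eval_prod] using h

end Selberg

/-! ### The coefficient of the leading form -/

section Coefficient

theorem ascPochhammer_eval_neg_natCast (x k : ℕ) :
    (ascPochhammer ℤ k).eval (-(x : ℤ)) = (-1) ^ k * (x.descFactorial k : ℤ) := by
  rw [ascPochhammer_eval_neg_eq_descPochhammer, descPochhammer_eval_eq_descFactorial]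

theorem coeff_sum_X_pow_mul_monomial {σ : Type*} [Fintype σ] (e α : σ →₀ ℕ) (N : ℕ) (c : ℤ)
    (h : e.degree = N + α.degree) :
    coeff e ((∑ i, X i) ^ N * monomial α c) * ∏ j, ((e j).factorial : ℤ) =
      (-1) ^ α.degree * N.factorial * risingMoment (fun j => -(e j : ℤ)) (monomial α c) := by
  rw [risingMoment_monomial, coeff_mul_monomial']
  simp only [ascPochhammer_eval_neg_natCast, prod_mul_distrib, prod_pow_eq_pow_sum,
    ← Finsupp.degree_eq_sum]
  have hs : ((-1 : ℤ) ^ α.degree) * (-1) ^ α.degree = 1 := by rw [← mul_pow]; simp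
  split_ifs with hle
  · obtain ⟨β, rfl⟩ := exists_add_of_le hle
    have hβ : β.degree = N := by rw [map_add] at h; omega
    rw [add_tsub_cancel_left, coeff_sum_X_pow_of_fintype, if_pos (show (β.sum fun _ k => k) = N from hβ)]
    have h1 := Nat.multinomial_spec univ β
    rw [← Finsupp.degree_eq_sum, hβ, ← Finsupp.multinomial_eq_of_support_subset (subset_univ _)]
      at h1
    have h2 : ∏ j, ((α + β) j).factorial =
        (∏ j, (β j).factorial) * ∏ j, ((α + β) j).descFactorial (α j) := by
      rw [← prod_mul_distrib]
      refine prod_congr rfl fun j _ => ?_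
      rw [← Nat.factorial_mul_descFactorial (n := (α + β) j) (k := α j) (by simp)]
      simp
    rw [← Nat.cast_prod, h2, ← h1]
    simp only [Finsupp.add_apply]
    push_cast
    linear_combination -((β.multinomial : ℤ) * c * (∏ j, ((β j).factorial : ℤ)) *
      ∏ j, ((α j + β j).descFactorial (α j) : ℤ)) * hs
  · obtain ⟨j, hj⟩ : ∃ j, e j < α j := by
      simpa [Finsupp.le_def] using hle
    rw [prod_eq_zero (i := j) (f := fun j => ((e j).descFactorial (α j) : ℤ)) (mem_univ j)
      (by simpa using hj)]
    simp

/-- Extracting a coefficient after multiplication by a power of `∑ xᵢ` amounts to applying the functional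
`risingMoment` at the negated exponents. -/
theorem coeff_sum_X_pow_mul {σ : Type*} [Fintype σ] {f : MvPolynomial σ ℤ} {d : ℕ}
    (hf : f.IsHomogeneous d) (e : σ →₀ ℕ) (N : ℕ) (h : e.degree = N + d) :
    coeff e ((∑ i, X i) ^ N * f) * ∏ j, ((e j).factorial : ℤ) =
      (-1) ^ d * N.factorial * risingMoment (fun j => -(e j : ℤ)) f := by
  rw [f.as_sum, mul_sum, coeff_sum, sum_mul, map_sum, mul_sum]
  refine sum_congr rfl fun α hα => ?_
  have hd : α.degree = d := by
    by_contra hne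
    exact (mem_support_iff.mp hα) (hf.coeff_eq_zero hne)
  rw [coeff_sum_X_pow_mul_monomial e α N _ (hd ▸ h), hd]

/-- The coefficient of `∏ xⱼ ^ eⱼ` in `(∑ xᵢ) ^ N * diffProd` divides `N! ∏_{1 ≤ j ≤ n} (m j)!`, when
the exponents are `q - 1` on `T` and `q` off `T`. -/
theorem exists_coeff_mul_eq {n m N q : ℕ} (e : Fin n →₀ ℕ) (T : Finset (Fin n))
    (hT : ∀ j, e j + (if j ∈ T then 1 else 0) = q) (hq : m * (n - 1) < q)
    (he : e.degree = N + m * (n * (n - 1))) :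
    ∃ B : ℤ, coeff e ((∑ i, X i) ^ N * diffProd (Fin n) ℤ m) * B =
      N.factorial * ∏ j ∈ range n, ((m * (j + 1)).factorial : ℤ) := by
  have hcoeff := coeff_sum_X_pow_mul (by simpa using isHomogeneous_diffProd (Fin n) ℤ m) e N he
  rw [Even.neg_one_pow ((Nat.even_mul_pred_self n).mul_left m), one_mul] at hcoeff
  set Z := coeff e ((∑ i, X i) ^ N * diffProd (Fin n) ℤ m)
  -- The vector `-e` is the constant `-q` raised by one on `T`, so Aomoto's recursion applies.
  have hshift := risingMoment_prod_X_mul_diffProd m (-q : ℤ) T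
  rw [risingMoment_prod_X_mul, show (fun j => (-q : ℤ) + if j ∈ T then 1 else 0) =
    fun j => -(e j : ℤ) by ext j; rw [← hT j]; push_cast; ring, prod_const] at hshift
  have hsel := risingMoment_diffProd n m (-q : ℤ)
  simp only [ascPochhammer_eval_neg_natCast] at hsel
  have hle : ∀ j ∈ range n, m * j < q := fun j hj =>
    (Nat.mul_le_mul_left m (by have := mem_range.mp hj; omega)).trans_lt hq
  have hTn : #T ≤ n := by simpa using card_le_univ T
  have hlin : ∏ t ∈ range #T, (-q + m * ((Fintype.card (Fin n) : ℤ) - 1 - t) : ℤ) =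
      (-1) ^ #T * ((∏ t ∈ range #T, (q - m * (n - 1 - t)) : ℕ) : ℤ) := by
    nth_rewrite 2 [← card_range #T]
    rw [← prod_const, Nat.cast_prod, ← prod_mul_distrib]
    refine prod_congr rfl fun t ht => ?_
    have ht' := mem_range.mp ht
    have := hle (n - 1 - t) (mem_range.mpr (by omega))
    rw [Nat.cast_sub this.le, Nat.cast_mul, Nat.sub_sub, Nat.cast_sub (by omega), Fintype.card_fin]
    push_cast; ring
  have hdesc : (∏ j ∈ range n, (-1) ^ (m * j) * ((m * (j + 1)).factorial : ℤ) *
      ((-1) ^ (m * j) * (q.descFactorial (m * j) : ℤ))) *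
      ∏ j ∈ range n, ((q - m * j).factorial : ℤ) =
      (∏ j ∈ range n, ((m * (j + 1)).factorial : ℤ)) * (q.factorial : ℤ) ^ n := by
    rw [show (q.factorial : ℤ) ^ n = ∏ _j ∈ range n, (q.factorial : ℤ) by simp, ← prod_mul_distrib, ← prod_mul_distrib]
    refine prod_congr rfl fun j hj => ?_
    have h1 : ((-1 : ℤ) ^ (m * j)) * (-1) ^ (m * j) = 1 := by rw [← mul_pow]; simp
    rw [← Nat.factorial_mul_descFactorial (hle j hj).le]
    push_cast
    linear_combination ((m * (j + 1)).factorial : ℤ) * (q.descFactorial (m * j) : ℤ) *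
      ((q - m * j).factorial : ℤ) * h1
  have hfac : (∏ j, ((e j).factorial : ℤ)) * (q : ℤ) ^ #T = (q.factorial : ℤ) ^ n := by
    have h1 : ∏ t ∈ T, (q : ℤ) = ∏ j, if j ∈ T then (q : ℤ) else 1 := by simp
    rw [← prod_const, h1, ← prod_mul_distrib,
      show (q.factorial : ℤ) ^ n = ∏ _j : Fin n, (q.factorial : ℤ) by simp]
    refine prod_congr rfl fun j _ => ?_
    have := hT j
    split_ifs at this ⊢
    · rw [← this, Nat.factorial_succ]; push_cast; ring
    · rw [← this]; simp
  -- The linear factors from the recursion may vanish modulo the characteristic; they cancel against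
  -- the factorials `(q - m j)!`.
  obtain ⟨W, hW⟩ : ∏ t ∈ range #T, (q - m * (n - 1 - t)) ∣
      ∏ j ∈ range n, (q - m * j).factorial := by
    rw [← prod_range_reflect (fun j => (q - m * j).factorial) n]
    refine (prod_dvd_prod_of_dvd _ _ fun t ht => ?_).trans
      (prod_dvd_prod_of_subset _ _ _ (range_subset_range.mpr hTn))
    have ht' := mem_range.mp ht
    have := hle (n - 1 - t) (mem_range.mpr (by omega))
    exact Nat.dvd_factorial (by omega) le_rfl
  have hW' := congrArg (Nat.cast : ℕ → ℤ) hW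
  set Y := ∏ t ∈ range #T, (q - m * (n - 1 - t))
  have hY0 : (Y : ℤ) ≠ 0 := by
    rw [Nat.cast_ne_zero]
    refine prod_ne_zero_iff.mpr fun t ht => ?_
    have ht' := mem_range.mp ht
    have := hle (n - 1 - t) (mem_range.mpr (by omega))
    omega
  rw [hlin, neg_pow] at hshift
  have hshift' : (q : ℤ) ^ #T * risingMoment (fun j => -(e j : ℤ)) (diffProd (Fin n) ℤ m) =
      Y * risingMoment (fun _ => -(q : ℤ)) (diffProd (Fin n) ℤ m) := by
    apply mul_left_cancel₀ (pow_ne_zero #T (show (-1 : ℤ) ≠ 0 by norm_num))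
    linear_combination hshift
  have hq0 : ((q.factorial : ℤ)) ^ n ≠ 0 := pow_ne_zero _ (by exact_mod_cast q.factorial_ne_zero)
  refine ⟨(m.factorial : ℤ) ^ n * W, mul_left_cancel₀ (mul_ne_zero hq0 hY0) ?_⟩
  push_cast at hW'
  rw [← hsel, hW'] at hdesc
  rw [← hfac] at hdesc ⊢
  linear_combination (q : ℤ) ^ #T * (m.factorial : ℤ) ^ n * Y * W * hcoeff +
    N.factorial * (m.factorial : ℤ) ^ n * Y * W * hshift' + N.factorial * Y * hdesc

end Coefficient

/-! ### Leading forms -/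

section LeadingForm

variable {σ R : Type*} [CommRing R]

/-- `q` is homogeneous of degree `d` and `p - q` has degree less than `d`. The form `q` may be zero, so
that no condition on `R` is needed for multiplicativity. -/
def HasLeadingForm (p q : MvPolynomial σ R) (d : ℕ) : Prop :=
  q.IsHomogeneous d ∧ ∀ α : σ →₀ ℕ, d ≤ α.degree → coeff α p = coeff α q

theorem MvPolynomial.IsHomogeneous.hasLeadingForm {q : MvPolynomial σ R} {d : ℕ}
    (hq : q.IsHomogeneous d) : HasLeadingForm q q d :=
  ⟨hq, fun _ _ => rfl⟩

theorem MvPolynomial.IsHomogeneous.hasLeadingForm_sub_C {q : MvPolynomial σ R}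
    (hq : q.IsHomogeneous 1) (c : R) : HasLeadingForm (q - C c) q 1 := by
  classical
  refine ⟨hq, fun α hα => ?_⟩
  rw [coeff_sub, coeff_C, if_neg, sub_zero]
  rintro rfl
  simp at hα

namespace HasLeadingForm

variable {p p' q q' : MvPolynomial σ R} {d d' : ℕ}

theorem mul (h : HasLeadingForm p q d) (h' : HasLeadingForm p' q' d') :
    HasLeadingForm (p * p') (q * q') (d + d') := by
  classical
  refine ⟨h.1.mul h'.1, fun α hα => ?_⟩
  rw [coeff_mul, coeff_mul]
  refine sum_congr rfl fun x hx => ?_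
  rw [← mem_antidiagonal.mp hx, map_add] at hα
  by_cases h1 : d ≤ x.1.degree
  · by_cases h2 : d' ≤ x.2.degree
    · rw [h.2 _ h1, h'.2 _ h2]
    · have h3 : q.coeff x.1 = 0 := h.1.coeff_eq_zero (by omega)
      rw [h.2 _ h1, h3, zero_mul, zero_mul]
  · have h3 : q'.coeff x.2 = 0 := h'.1.coeff_eq_zero (by omega)
    rw [h'.2 _ (by omega), h3, mul_zero, mul_zero]

theorem prod {ι : Type*} (s : Finset ι) {p q : ι → MvPolynomial σ R} {d : ι → ℕ}
    (h : ∀ i ∈ s, HasLeadingForm (p i) (q i) (d i)) :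
    HasLeadingForm (∏ i ∈ s, p i) (∏ i ∈ s, q i) (∑ i ∈ s, d i) := by
  classical
  induction s using Finset.induction_on with
  | empty => exact (isHomogeneous_one σ R).hasLeadingForm
  | insert a s ha ih =>
    rw [prod_insert ha, prod_insert ha, sum_insert ha]
    exact (h a (mem_insert_self a s)).mul (ih fun i hi => h i (mem_insert_of_mem hi))

theorem totalDegree_le (h : HasLeadingForm p q d) : p.totalDegree ≤ d := by
  refine Finset.sup_le fun α hα => ?_
  by_contra hlt
  rw [not_le] at hlt
  change d < α.degree at hlt
  exact mem_support_iff.mp hα ((h.2 α hlt.le).trans (h.1.coeff_eq_zero hlt.ne'))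

end HasLeadingForm

end LeadingForm

/-! ### The polynomial method -/

section Sumset

theorem finite_restrictedSumset {F : Type*} [Field F] {n : ℕ} (A : Fin n → Finset F)
    (S : Fin n → Fin n → Finset F) : (restrictedSumset A S).Finite := by
  classical
  refine ((Fintype.piFinset A).image fun a => ∑ j, a j).finite_toSet.subset ?_
  rintro c ⟨a, ha, -, rfl⟩
  exact mem_coe.mpr (mem_image_of_mem _ (Fintype.mem_piFinset.mpr ha))

/-- The Combinatorial Nullstellensatz applied to restricted sumsets: a nonzero coefficient forces more
than `N` elements. -/
theorem lt_ncard_restrictedSumset_of_coeff_ne_zero {F : Type*} [Field F] {n m N : ℕ}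
    (A : Fin n → Finset F) (S : Fin n → Fin n → Finset F)
    (hS : ∀ i j, i ≠ j → (S i j).card = m) (e : Fin n →₀ ℕ) (heA : ∀ j, e j < #(A j))
    (he : e.degree = N + m * (n * (n - 1)))
    (hcoeff : coeff e ((∑ i, X i) ^ N * diffProd (Fin n) F m) ≠ 0) :
    N < (restrictedSumset A S).ncard := by
  by_contra! hle
  have hfin := finite_restrictedSumset A S
  rw [Set.ncard_eq_toFinset_card _ hfin] at hle
  set V := hfin.toFinset with hV
  have hsumX : (∑ i, X i : MvPolynomial (Fin n) F).IsHomogeneous 1 :=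
    IsHomogeneous.sum _ _ _ fun i _ => isHomogeneous_X F i
  -- The power of `∑ xᵢ` pads the degree to exactly `N`.
  set P : MvPolynomial (Fin n) F := (∑ i, X i) ^ (N - #V) * ∏ c ∈ V, ((∑ i, X i) - C c) with hP
  set Q : MvPolynomial (Fin n) F := ∏ p ∈ (univ : Finset (Fin n)).offDiag,
    ∏ s ∈ S p.1 p.2, (X p.1 - X p.2 - C s) with hQ
  have hPlead : HasLeadingForm P ((∑ i, X i) ^ N) N := by
    have h := (hsumX.pow (N - #V)).hasLeadingForm.mul
      (HasLeadingForm.prod V fun c _ => hsumX.hasLeadingForm_sub_C c)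
    rwa [prod_const, ← pow_add, sum_const, smul_eq_mul, mul_one, one_mul,
      Nat.sub_add_cancel hle] at h
  have hQlead : HasLeadingForm Q (diffProd (Fin n) F m) (m * (n * (n - 1))) := by
    have h := HasLeadingForm.prod (univ : Finset (Fin n)).offDiag fun p _ =>
      HasLeadingForm.prod (S p.1 p.2) fun s _ =>
        ((isHomogeneous_X F p.1).sub (isHomogeneous_X F p.2)).hasLeadingForm_sub_C s
    have hcard : ∀ p ∈ (univ : Finset (Fin n)).offDiag, #(S p.1 p.2) = m := fun p hp =>
      hS _ _ (mem_offDiag.mp hp).2.2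
    have hD : diffProd (Fin n) F m =
        ∏ p ∈ (univ : Finset (Fin n)).offDiag, (X p.1 - X p.2) ^ #(S p.1 p.2) :=
      prod_congr rfl fun p hp => by rw [hcard p hp]
    simp only [prod_const, sum_const, smul_eq_mul, mul_one] at h
    rwa [sum_congr rfl hcard, ← hD, sum_const, offDiag_card, card_univ, Fintype.card_fin,
      smul_eq_mul, mul_comm, ← Nat.mul_sub_one] at h
  have hlead := hPlead.mul hQlead
  have hne : coeff e (P * Q) ≠ 0 := by rwa [hlead.2 e he.ge]
  have hdeg : (P * Q).totalDegree = e.degree :=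
    le_antisymm (he ▸ hlead.totalDegree_le) (le_totalDegree (mem_support_iff.mpr hne))
  obtain ⟨a, haA, ha⟩ := combinatorial_nullstellensatz_exists_eval_nonzero _ e hne hdeg A heA
  rw [map_mul] at ha
  have haC : ∑ j, a j ∈ V := by
    rw [hV, Set.Finite.mem_toFinset]
    refine ⟨a, haA, fun i j hij hs => right_ne_zero_of_mul ha ?_, rfl⟩
    rw [hQ, map_prod]
    refine prod_eq_zero (i := (i, j)) (by simp [hij]) ?_
    rw [map_prod]
    exact prod_eq_zero hs (by simp)
  refine left_ne_zero_of_mul ha ?_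
  rw [hP, map_mul, map_prod, prod_eq_zero haC (by simp), mul_zero]

theorem natCast_factorial_ne_zero {F : Type*} [Field F] {M : ℕ}
    (h : addOrderOf (1 : F) = 0 ∨ M < addOrderOf (1 : F)) : (M.factorial : F) ≠ 0 := by
  have hchar := CharP.addOrderOf_one F
  rw [Ne, CharP.cast_eq_zero_iff F (addOrderOf (1 : F))]
  rcases CharP.char_is_prime_or_zero F (addOrderOf (1 : F)) with hp | h0
  · rw [hp.dvd_factorial]
    rcases h with h | h
    · exact absurd h hp.ne_zero
    · omega
  · rw [h0, zero_dvd_iff]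
    exact M.factorial_ne_zero

theorem coeff_sum_X_pow_mul_diffProd_ne_zero {F : Type*} [Field F] {n m N q : ℕ} (e : Fin n →₀ ℕ)
    (T : Finset (Fin n)) (hT : ∀ j, e j + (if j ∈ T then 1 else 0) = q) (hq : m * (n - 1) < q)
    (he : e.degree = N + m * (n * (n - 1)))
    (hp : addOrderOf (1 : F) = 0 ∨ m * n < addOrderOf (1 : F) ∧ N < addOrderOf (1 : F)) :
    coeff e ((∑ i, X i) ^ N * diffProd (Fin n) F m) ≠ 0 := by
  obtain ⟨B, hB⟩ := exists_coeff_mul_eq e T hT hq he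
  have hmap : ((∑ i, X i) ^ N * diffProd (Fin n) F m) =
      map (Int.castRingHom F) ((∑ i, X i) ^ N * diffProd (Fin n) ℤ m) := by
    simp [map_diffProd]
  rw [hmap, coeff_map]
  have h := congrArg (Int.castRingHom F) hB
  rw [map_mul] at h
  refine left_ne_zero_of_mul (b := Int.castRingHom F B) ?_
  rw [h]
  simp only [map_mul, map_prod, eq_intCast, Int.cast_natCast]
  refine mul_ne_zero (natCast_factorial_ne_zero (hp.imp_right And.right)) ?_
  refine prod_ne_zero_iff.mpr fun j hj => natCast_factorial_ne_zero (hp.imp_right fun h => ?_)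
  exact (Nat.mul_le_mul_left m (mem_range.mp hj)).trans_lt h.1

end Sumset

theorem theorem1p2 {F : Type*} [Field F] (n m k : ℕ)
    (A : Fin n → Finset F) (S : Fin n → Fin n → Finset F)
    (hne : ∀ j, (A j).Nonempty)
    (hS : ∀ i j, i ≠ j → (S i j).card = m)
    (hA : ∀ j, (A j).card = k ∨ (A j).card = k + 1)
    (hp : ((max ((m : ℤ) * n)
        ((∑ j, (((A j).card : ℤ) - 1)) - (m : ℤ) * n * ((n : ℤ) - 1)) : ℤ) : WithTop ℤ)
      < orderOfIdentity F) :
    (∑ j, (((A j).card : ℤ) - 1)) - (m : ℤ) * n * ((n : ℤ) - 1) + 1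
      ≤ ((restrictedSumset A S).ncard : ℤ) := by
  classical
  set I := (∑ j, (((A j).card : ℤ) - 1)) - (m : ℤ) * n * ((n : ℤ) - 1) with hI
  -- For a negative `I` the claimed bound is at most `0`.
  rcases lt_or_ge I 0 with hneg | hnonneg
  · have : (0 : ℤ) ≤ (restrictedSumset A S).ncard := Nat.cast_nonneg _
    omega
  obtain ⟨N, hN⟩ := Int.eq_ofNat_of_zero_le hnonneg
  have hpos : ∀ j, 1 ≤ #(A j) := fun j => card_pos.mpr (hne j)
  set e : Fin n →₀ ℕ := Finsupp.equivFunOnFinite.symm fun j => #(A j) - 1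
  have hej : ∀ j, e j = #(A j) - 1 := fun j => rfl
  have hdegI : (e.degree : ℤ) = ∑ j, ((#(A j) : ℤ) - 1) := by
    rw [Finsupp.degree_eq_sum, Nat.cast_sum]
    exact sum_congr rfl fun j _ => by rw [hej, Nat.cast_sub (hpos j), Nat.cast_one]
  have hpred : ((n * (n - 1) : ℕ) : ℤ) = n * ((n : ℤ) - 1) := by
    rcases n with _ | n <;> simp
  have hdeg : e.degree = N + m * (n * (n - 1)) := by
    have h : (e.degree : ℤ) = N + m * ((n * (n - 1) : ℕ) : ℤ) := by
      rw [hdegI, hpred]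
      linear_combination hN
    exact_mod_cast h
  have hchar : addOrderOf (1 : F) = 0 ∨ m * n < addOrderOf (1 : F) ∧ N < addOrderOf (1 : F) := by
    unfold orderOfIdentity at hp
    split_ifs at hp with h0
    · exact Or.inl h0
    · rw [WithTop.coe_lt_coe, max_lt_iff, hN] at hp
      exact Or.inr ⟨by exact_mod_cast hp.1, by exact_mod_cast hp.2⟩
  -- Choosing `q` as one more than the least exponent makes `m (n - 1) < q` follow from `N ≥ 0`.
  obtain ⟨q, T, hT, hq⟩ : ∃ (q : ℕ) (T : Finset (Fin n)),
      (∀ j, e j + (if j ∈ T then 1 else 0) = q) ∧ m * (n - 1) < q := by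
    by_cases hall : ∀ j, #(A j) = k + 1
    · refine ⟨k + 1, univ, fun j => by simp [hej, hall], Nat.lt_succ_of_le ?_⟩
      rcases Nat.eq_zero_or_pos n with rfl | hn
      · simp
      have hsum : e.degree = n * k := by
        rw [Finsupp.degree_eq_sum, sum_congr rfl fun j _ => show e j = k by simp [hej, hall]]
        simp
      refine Nat.le_of_mul_le_mul_left ?_ hn
      rw [← hsum, hdeg, Nat.mul_left_comm]
      exact Nat.le_add_left _ _
    · push Not at hall
      obtain ⟨i, hi⟩ := hall
      have hik := (hA i).resolve_right hi
      have hk : 1 ≤ k := hik ▸ hpos i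
      refine ⟨k, univ.filter fun j => #(A j) = k, fun j => ?_, ?_⟩
      · rw [hej]
        rcases hA j with h | h <;> simp [h]
        omega
      · have hlt : e.degree < n * k := by
          rw [Finsupp.degree_eq_sum, show n * k = ∑ _j : Fin n, k by simp]
          refine sum_lt_sum (fun j _ => ?_) ⟨i, mem_univ i, ?_⟩
          · rw [hej]; rcases hA j with h | h <;> omega
          · rw [hej]; omega
        refine Nat.lt_of_mul_lt_mul_left (a := n) (lt_of_le_of_lt ?_ hlt)
        rw [hdeg, Nat.mul_left_comm]
        exact Nat.le_add_left _ _
  have hlt := lt_ncard_restrictedSumset_of_coeff_ne_zero A S hS e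
    (fun j => by have := hpos j; rw [hej]; omega) hdeg
    (coeff_sum_X_pow_mul_diffProd_ne_zero e T hT hq hdeg hchar)
  rw [hN]
  exact_mod_cast hlt
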